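/- Let $(M,\rho)$ be a metric space. For $\beta\ge 1$ and $\Delta>0$, a probability distribution $\mathcal D$ over partitions of $M$ is called a $(\beta,\Delta)$-Lipschitz decomposition of $M$ if (i) for every partition $P$ in the support of $\mathcal D$, every cluster $C\in P$ satisfies $\operatorname{diam}(C)\le\Delta$; and (ii) for all $x,y\in M$, $\Pr_{P\sim\mathcal D}[P(x)\ne P(y)]\le \beta\,\rho(x,y)/\Delta$, where $P(z)$ denotes the cluster of $P$ that contains $z$. The decomposition parameter of $M$ is $$\beta^*(M)=\inf\{\beta\ge 1:\ \text{for all }\Delta>0,\ \text{every finite } M'\subseteq M \text{ admits a } (\beta,\Delta)\text{-Lipschitz decomposition}\}\in[1,\infty].$$ Let $\ell_p^d$ denote $\mathbb R^d$ with the metric induced by the $\ell_p$ norm. Then there is a universal constant $C$ such that for every $p\in[2,\infty]$ and every integer $d\ge 2$, $$\beta^*(\ell_p^d)\ \le\ C\cdot(\min\{p,\log d\})^4\cdot\sqrt d ,$$ and moreover, for $d=1$, $\beta^*(\ell_p^1)\le C$ for every $p\in[2,\infty]$. -/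

import Mathlib

open scoped ENNReal NNReal

/-- The cluster `P(z)` of the partition `P` (given as an equivalence relation, its clusters being
the equivalence classes) that contains the point `z`. -/
def cluster {M : Type*} (P : Setoid M) (z : M) : Set M := {w | P w z}

/-- The distribution `D` over partitions of the metric space `M` is a `(β, Δ)`-Lipschitz
decomposition. Distributions are discrete probability distributions; when `M` is finite there are
only finitely many partitions, so that every distribution over them is of this kind. The diameter
is the extended one (the supremum of the distances, with value in `[0, ∞]`). -/
def IsLipschitzDecomposition {M : Type*} [MetricSpace M] (D : PMF (Setoid M)) (β Δ : ℝ) : Prop :=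
  (∀ P ∈ D.support, ∀ C ∈ P.classes, Metric.ediam C ≤ ENNReal.ofReal Δ) ∧
  (∀ x y : M, D.toOuterMeasure {P | cluster P x ≠ cluster P y} ≤
    ENNReal.ofReal (β * (dist x y / Δ)))

/-- The decomposition parameter `β*(M)`: the infimum of the real numbers `β ≥ 1` such that for
every `Δ > 0` every finite subset of `M` admits a `(β, Δ)`-Lipschitz decomposition (it is `∞` if
there is no such `β`). -/
noncomputable def decompositionParameter (M : Type*) [MetricSpace M] : ℝ≥0∞ :=
  sInf {b : ℝ≥0∞ | ∃ β : ℝ, b = ENNReal.ofReal β ∧ 1 ≤ β ∧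
    ∀ Δ : ℝ, 0 < Δ → ∀ S : Set M, S.Finite →
      ∃ D : PMF (Setoid S), IsLipschitzDecomposition D β Δ}

open MeasureTheory

/-! Draw a random set from a translation-invariant measure, carve it off as a cluster, and repeat on
the points that are left. A pair is separated only if the first set meeting it splits it, so the
separation probability is at most the ratio (measure of sets splitting `x`, `y`) / (measure of sets
containing `x`).

The sets are superlevel sets of translates of a density `f` on `ℝᵈ`, with the translation and the
level both drawn from Lebesgue measure. The ratio then becomes the `L¹` distance of two translates
of `f` divided by `∫ f`, and the diameters are controlled by the support of `f`.

Take for `f` a Gaussian cut off at `ℓ_p` radius `R`. Translating the Gaussian by `v` costs at most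
`‖v‖₂`, which is at most `d^(1/2 - 1/p) ‖v‖_p`, while `R` of order `d^(1/p) min(p, log d)` keeps a
constant share of the mass. The product is of order `√d · min(p, log d)`, so the fourth power in the
claim leaves room to spare. The main estimates are `exists_pmf_setoid_of_weights`,
`integral_abs_gaussianWeight_sub_le` and `integral_gaussianWeight_le_integral_truncatedGaussian`. -/

/-! ### Carving partitions out of random sets -/

/-- The partition obtained from `P` by making `A` a single cluster. -/
def Setoid.carve {M : Type*} (A : Set M) (P : Setoid M) : Setoid M where
  r x y := (x ∈ A ∧ y ∈ A) ∨ (x ∉ A ∧ y ∉ A ∧ P x y)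
  iseqv :=
    { refl := fun x => by
        by_cases h : x ∈ A
        · exact Or.inl ⟨h, h⟩
        · exact Or.inr ⟨h, h, P.refl' x⟩
      symm := by
        rintro x y (⟨h, h'⟩ | ⟨h, h', h''⟩)
        · exact Or.inl ⟨h', h⟩
        · exact Or.inr ⟨h', h, P.symm' h''⟩
      trans := by
        rintro x y z (⟨h, h'⟩ | ⟨h, h', h''⟩) (⟨k, k'⟩ | ⟨k, k', k''⟩)
        · exact Or.inl ⟨h, k'⟩
        · exact absurd h' k
        · exact absurd k h'
        · exact Or.inr ⟨h, k', P.trans' h'' k''⟩ }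

theorem Setoid.carve_apply {M : Type*} {A : Set M} {P : Setoid M} {x y : M} :
    Setoid.carve A P x y ↔ (x ∈ A ∧ y ∈ A) ∨ (x ∉ A ∧ y ∉ A ∧ P x y) := Iff.rfl

/-- Carving clusters off one after the other: every time, a set is drawn with probability
proportional to its weight among the sets that meet the remaining points. -/
theorem exists_pmf_setoid_of_weights {M : Type*} [Finite M] (w : Set M → ℝ≥0∞)
    (hw : ∑' A, w A ≠ ∞) (r : M → M → Prop) (hr : ∀ A, w A ≠ 0 → ∀ x ∈ A, ∀ y ∈ A, r x y)
    (hpos : ∀ x, ∃ A, x ∈ A ∧ w A ≠ 0) (ε : M → M → ℝ≥0∞)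
    (hsep : ∀ x y, ∑' A, {A : Set M | ¬(x ∈ A ↔ y ∈ A)}.indicator w A ≤
      ε x y * ∑' A, {A : Set M | x ∈ A}.indicator w A) (U : Set M) :
    ∃ D : PMF (Setoid M), (∀ P ∈ D.support, ∀ x y, P x y → x ≠ y → r x y) ∧
      ∀ x ∈ U, ∀ y ∈ U, D.toOuterMeasure {P | ¬P x y} ≤ ε x y := by
  classical
  induction U using WellFoundedLT.induction with
  | _ U ih =>
  rcases U.eq_empty_or_nonempty with rfl | ⟨u, hu⟩
  -- Points outside `U` end up as singletons, so `r` is only needed for distinct points.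
  · refine ⟨PMF.pure ⊥, ?_, by simp⟩
    intro P hP x y hxy hne
    rw [PMF.support_pure, Set.mem_singleton_iff] at hP
    subst hP
    exact absurd hxy hne
  set 𝒜 : Set (Set M) := {A | (A ∩ U).Nonempty} with h𝒜
  have hlt : ∀ A ∈ 𝒜, U \ A < U := by
    rintro A ⟨a, ha, haU⟩
    exact ⟨Set.sdiff_subset, fun h => (h haU).2 ha⟩
  choose! D hD using fun A hA => ih (U \ A) (hlt A hA)
  set v : Set M → ℝ≥0∞ := 𝒜.indicator w with hv
  have hvle : ∀ A, v A ≤ w A := fun A => Set.indicator_le_self _ _ _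
  have hvfin : ∑' A, v A ≠ ∞ := ne_top_of_le_ne_top hw (ENNReal.tsum_le_tsum hvle)
  have hv0 : ∑' A, v A ≠ 0 := by
    obtain ⟨A, hA, hwA⟩ := hpos u
    intro h
    have := ENNReal.tsum_eq_zero.1 h A
    rw [hv, Set.indicator_of_mem (show A ∈ 𝒜 from ⟨u, hA, hu⟩)] at this
    exact hwA this
  set q := PMF.normalize v hv0 hvfin with hq
  have hsupp : ∀ A ∈ q.support, A ∈ 𝒜 ∧ w A ≠ 0 := by
    intro A hA
    rw [PMF.mem_support_normalize_iff] at hA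
    have : A ∈ 𝒜 := by
      by_contra h
      exact hA (Set.indicator_of_notMem h _)
    exact ⟨this, fun h => hA (le_antisymm ((hvle A).trans h.le) bot_le)⟩
  refine ⟨q.bind fun A => (D A).map (Setoid.carve (A ∩ U)), ?_, ?_⟩
  · intro P hP x y hxy hne
    rw [PMF.mem_support_bind_iff] at hP
    obtain ⟨A, hA, hP⟩ := hP
    rw [PMF.mem_support_map_iff] at hP
    obtain ⟨Q, hQ, rfl⟩ := hP
    obtain ⟨hA𝒜, hwA⟩ := hsupp A hA
    rcases hxy with ⟨hx, hy⟩ | ⟨-, -, h⟩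
    · exact hr A hwA x hx.1 y hy.1
    · exact (hD A hA𝒜).1 Q hQ x y h hne
  · intro x hx y hy
    rw [PMF.toOuterMeasure_bind_apply]
    -- Condition on the first set `A`: if it splits the pair, bound the probability by 1; if it
    -- contains both points, they stay together; if it contains neither, both survive in `U \ A` and
    -- the induction hypothesis gives `ε x y`.
    have key : ∀ A, q A * ((D A).map (Setoid.carve (A ∩ U))).toOuterMeasure {P | ¬P x y} ≤
        ({A : Set M | ¬(x ∈ A ↔ y ∈ A)}.indicator w A +
          ε x y * {A : Set M | x ∉ A}.indicator v A) * (∑' A, v A)⁻¹ := by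
      intro A
      rw [hq, PMF.normalize_apply, mul_right_comm]
      gcongr
      by_cases hA : A ∈ 𝒜
      swap
      · rw [show v A = 0 from Set.indicator_of_notMem hA _]
        simp
      rw [PMF.toOuterMeasure_map_apply]
      by_cases hxy : x ∈ A ↔ y ∈ A
      · by_cases hxA : x ∈ A
        · have : Setoid.carve (A ∩ U) ⁻¹' {P | ¬P x y} = ∅ := by
            ext P
            simp [Setoid.carve_apply, hxA, hxy.1 hxA, hx, hy]
          rw [this]
          simp
        · have : Setoid.carve (A ∩ U) ⁻¹' {P | ¬P x y} = {P | ¬P x y} := by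
            ext P
            simp [Setoid.carve_apply, hxA, mt hxy.2 hxA]
          rw [this]
          refine le_trans ?_ le_add_self
          rw [Set.indicator_of_mem (show A ∈ {A : Set M | x ∉ A} from hxA), mul_comm]
          gcongr
          exact (hD A hA).2 x ⟨hx, hxA⟩ y ⟨hy, mt hxy.2 hxA⟩
      · refine le_trans ?_ le_self_add
        rw [Set.indicator_of_mem (show A ∈ {A : Set M | ¬(x ∈ A ↔ y ∈ A)} from hxy)]
        refine (mul_le_mul' (hvle A) ?_).trans (mul_one _).le
        refine (measure_mono (Set.subset_univ _)).trans ?_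
        rw [(PMF.toOuterMeasure_apply_eq_one_iff _ _).2 (Set.subset_univ _)]
    refine (ENNReal.tsum_le_tsum key).trans ?_
    rw [ENNReal.tsum_mul_right, ENNReal.tsum_add, ENNReal.tsum_mul_left]
    rw [← div_eq_mul_inv]
    refine ENNReal.div_le_of_le_mul ?_
    -- The splitting weight is at most `ε x y` times the weight of the sets containing `x`, which
    -- completes the `x ∉ A` term to the full total.
    refine (add_le_add_left (hsep x y) _).trans ?_
    rw [← mul_add, ← ENNReal.tsum_add]
    gcongr with A
    by_cases hxA : x ∈ A
    · have hA : A ∈ 𝒜 := ⟨x, hxA, hx⟩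
      simp [hxA, hv, hA]
    · simp [hxA]

theorem exists_isLipschitzDecomposition_of_random_sets {M Ω : Type*} [MetricSpace M] [Finite M]
    [MeasurableSpace Ω] (μ : Measure Ω) (X : Ω → Set M)
    (hX : ∀ x, MeasurableSet {ω | x ∈ X ω}) (hpos : ∀ x, μ {ω | x ∈ X ω} ≠ 0)
    (hfin : ∀ x, μ {ω | x ∈ X ω} ≠ ∞) {β Δ : ℝ}
    (hdiam : ∀ ω, ∀ x ∈ X ω, ∀ y ∈ X ω, dist x y ≤ Δ)
    (hΔ : 0 < Δ)
    (hsep : ∀ x y, μ {ω | ¬(x ∈ X ω ↔ y ∈ X ω)} ≤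
      ENNReal.ofReal (β * (dist x y / Δ)) * μ {ω | x ∈ X ω}) :
    ∃ D : PMF (Setoid M), IsLipschitzDecomposition D β Δ := by
  classical
  have hmeas : ∀ A : Set M, MeasurableSet (X ⁻¹' {A}) := by
    intro A
    have : X ⁻¹' {A} = ⋂ x, if x ∈ A then {ω | x ∈ X ω} else {ω | x ∈ X ω}ᶜ := by
      ext ω
      simp only [Set.mem_preimage, Set.mem_singleton_iff, Set.mem_iInter, Set.ext_iff]
      refine forall_congr' fun x => ?_
      by_cases h : x ∈ A <;> simp [h]
    rw [this]
    refine MeasurableSet.iInter fun x => ?_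
    split_ifs
    · exact hX x
    · exact (hX x).compl
  have hsum : ∀ 𝒜 : Set (Set M),
      ∑' A, 𝒜.indicator (fun A => μ (X ⁻¹' {A})) A = μ {ω | X ω ∈ 𝒜} := by
    intro 𝒜
    rw [← tsum_subtype]
    exact tsum_measure_preimage_singleton 𝒜.to_countable fun A _ => hmeas A
  -- The empty set may be attained on a set of infinite measure; it contains no point and splits no
  -- pair, so it is given weight zero.
  set w : Set M → ℝ≥0∞ := {A : Set M | A.Nonempty}.indicator fun A => μ (X ⁻¹' {A}) with hw
  have hind : ∀ 𝒜 : Set (Set M), ∅ ∉ 𝒜 →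
      𝒜.indicator w = 𝒜.indicator (fun A => μ (X ⁻¹' {A})) := by
    intro 𝒜 h
    rw [hw, Set.indicator_indicator, Set.inter_eq_left.2]
    intro A hA
    exact Set.nonempty_iff_ne_empty.2 fun h' => h (h' ▸ hA)
  have hwle : ∀ A, w A ≤ μ (X ⁻¹' {A}) := fun A => Set.indicator_le_self _ _ _
  obtain ⟨D, hD, hD'⟩ := exists_pmf_setoid_of_weights w
    (by
      have := Fintype.ofFinite (Set M)
      rw [tsum_eq_sum (s := Finset.univ) (by simp)]
      refine ENNReal.sum_ne_top.2 fun A _ => ?_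
      by_cases hA : A.Nonempty
      · obtain ⟨x, hx⟩ := hA
        refine ne_top_of_le_ne_top (hfin x) ((hwle A).trans (measure_mono ?_))
        rintro ω rfl
        exact hx
      · rw [hw, Set.indicator_of_notMem (by exact hA)]
        simp)
    (fun x y => dist x y ≤ Δ)
    (by
      intro A hA x hx y hy
      have : μ (X ⁻¹' {A}) ≠ 0 := fun h => hA (le_antisymm ((hwle A).trans h.le) bot_le)
      obtain ⟨ω, rfl⟩ := nonempty_of_measure_ne_zero this
      exact hdiam ω x hx y hy)
    (by
      intro x
      by_contra! h
      apply hpos x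
      have := hsum {A | x ∈ A}
      rw [← hind _ (by simp)] at this
      refine this.symm.trans (ENNReal.tsum_eq_zero.2 fun A => ?_)
      by_cases hA : x ∈ A
      · simp [hA, h A hA]
      · simp [hA])
    (fun x y => ENNReal.ofReal (β * (dist x y / Δ)))
    (by
      intro x y
      rw [hind _ (by simp), hind _ (by simp), hsum, hsum]
      exact hsep x y) Set.univ
  refine ⟨D, ?_, ?_⟩
  · intro P hP C hC
    obtain ⟨z, rfl⟩ := hC
    refine Metric.ediam_le fun x hx y hy => ?_
    rw [edist_dist]
    refine ENNReal.ofReal_le_ofReal ?_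
    rcases eq_or_ne x y with rfl | hne
    · simpa using hΔ.le
    · exact hD P hP x y (P.trans' hx (P.symm' hy)) hne
  · intro x y
    refine le_trans (measure_mono ?_) (hD' x trivial y trivial)
    intro P hP h
    apply hP
    ext z
    exact ⟨fun hz => P.trans' hz h, fun hz => P.trans' hz (P.symm' h)⟩

/-- Carving with the superlevel sets of the translates of an integrable function. -/
theorem exists_isLipschitzDecomposition_of_density {M E : Type*} [MetricSpace M] [Finite M]
    [NormedAddCommGroup E] [InnerProductSpace ℝ E] [FiniteDimensional ℝ E] [MeasurableSpace E]
    [BorelSpace E] {f : E → ℝ} (hfc : Continuous f) (hf0 : ∀ x, 0 ≤ f x) (hfi : Integrable f)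
    (hfpos : 0 < ∫ x, f x) (T : M → E) {β Δ : ℝ} (hΔ : 0 < Δ) (hβ : 0 ≤ β)
    (hdiam : ∀ x y z, 0 < f (T x + z) → 0 < f (T y + z) → dist x y ≤ Δ)
    (hsep : ∀ x y, ∫ z, |f (T x + z) - f (T y + z)| ≤ β * (dist x y / Δ) * ∫ z, f z) :
    ∃ D : PMF (Setoid M), IsLipschitzDecomposition D β Δ := by
  have hfT : ∀ x, Continuous fun z => f (T x + z) := fun x => hfc.comp (by fun_prop)
  have hms : ∀ x, MeasurableSet {ω : E × ℝ | 0 < ω.2 ∧ ω.2 < f (T x + ω.1)} := by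
    intro x
    exact (measurableSet_lt measurable_const measurable_snd).inter
      (measurableSet_lt measurable_snd ((hfT x).measurable.comp measurable_fst))
  have hmass : ∀ x, (volume : Measure (E × ℝ)) {ω | 0 < ω.2 ∧ ω.2 < f (T x + ω.1)} =
      ENNReal.ofReal (∫ z, f z) := by
    intro x
    rw [Measure.volume_eq_prod, Measure.prod_apply (hms x)]
    have : ∀ z : E, volume (Prod.mk z ⁻¹' {ω : E × ℝ | 0 < ω.2 ∧ ω.2 < f (T x + ω.1)}) =
        ENNReal.ofReal (f (T x + z)) := by
      intro z
      have : Prod.mk z ⁻¹' {ω : E × ℝ | 0 < ω.2 ∧ ω.2 < f (T x + ω.1)} =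
          Set.Ioo 0 (f (T x + z)) := rfl
      rw [this, Real.volume_Ioo, sub_zero]
    simp_rw [this]
    rw [lintegral_add_left_eq_self (fun z => ENNReal.ofReal (f z)) (T x),
      ← ofReal_integral_eq_lintegral_ofReal hfi (Filter.Eventually.of_forall hf0)]
  refine exists_isLipschitzDecomposition_of_random_sets (volume : Measure (E × ℝ))
    (fun ω => {x | 0 < ω.2 ∧ ω.2 < f (T x + ω.1)}) hms ?_ ?_ ?_ hΔ ?_
  · intro x
    simpa only [Set.mem_ofPred_eq, hmass, ne_eq, ENNReal.ofReal_eq_zero, not_le] using hfpos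
  · intro x
    simp only [Set.mem_ofPred_eq, hmass]
    exact ENNReal.ofReal_ne_top
  · rintro ω x ⟨h, hx⟩ y ⟨-, hy⟩
    exact hdiam x y ω.1 (h.trans hx) (h.trans hy)
  · intro x y
    simp only [Set.mem_ofPred_eq, hmass]
    rw [← ENNReal.ofReal_mul (by positivity)]
    refine le_trans ?_ (ENNReal.ofReal_le_ofReal (hsep x y))
    have hint : Integrable fun z => |f (T x + z) - f (T y + z)| :=
      ((hfi.comp_add_left (T x)).sub (hfi.comp_add_left (T y))).abs
    rw [ofReal_integral_eq_lintegral_ofReal hint (Filter.Eventually.of_forall fun _ => abs_nonneg _),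
      Measure.volume_eq_prod]
    have hm : MeasurableSet {ω : E × ℝ | ¬((0 < ω.2 ∧ ω.2 < f (T x + ω.1)) ↔
        (0 < ω.2 ∧ ω.2 < f (T y + ω.1)))} := by
      have : {ω : E × ℝ | ¬((0 < ω.2 ∧ ω.2 < f (T x + ω.1)) ↔
          (0 < ω.2 ∧ ω.2 < f (T y + ω.1)))} =
          symmDiff {ω | 0 < ω.2 ∧ ω.2 < f (T x + ω.1)} {ω | 0 < ω.2 ∧ ω.2 < f (T y + ω.1)} := by
        ext ω
        simp only [Set.mem_ofPred_eq, Set.mem_symmDiff]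
        tauto
      rw [this]
      exact (hms x).symmDiff (hms y)
    rw [Measure.prod_apply hm]
    refine lintegral_mono fun z => ?_
    -- For a fixed translation `z`, only levels between the two values of `f` split the pair.
    refine (measure_mono (t := Set.Icc (min (f (T x + z)) (f (T y + z)))
      (max (f (T x + z)) (f (T y + z)))) ?_).trans ?_
    · intro t ht
      simp only [Set.mem_preimage, Set.mem_ofPred_eq] at ht
      simp only [Set.mem_Icc, min_le_iff, le_max_iff]
      grind
    · rw [Real.volume_Icc, max_sub_min_eq_abs, abs_sub_comm]

/-! ### `L¹` continuity of Gaussian translates -/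

section Gaussian

variable {E : Type*} [NormedAddCommGroup E]

/-- The unnormalised Gaussian density. -/
noncomputable def gaussianWeight (x : E) : ℝ := Real.exp (-(‖x‖ ^ 2 / 2))

theorem gaussianWeight_pos (x : E) : 0 < gaussianWeight x := Real.exp_pos _

theorem continuous_gaussianWeight : Continuous (gaussianWeight : E → ℝ) := by
  unfold gaussianWeight
  fun_prop

variable [InnerProductSpace ℝ E]

theorem exp_inner_mul_gaussianWeight (u x : E) :
    Real.exp (inner ℝ u x) * gaussianWeight x =
      Real.exp (‖u‖ ^ 2 / 2) * gaussianWeight (x - u) := by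
  unfold gaussianWeight
  rw [← Real.exp_add, ← Real.exp_add, norm_sub_sq_real, real_inner_comm]
  ring_nf

theorem gaussianWeight_mul_gaussianWeight_add (x v : E) :
    gaussianWeight (x + v) * gaussianWeight x =
      (Real.exp (-(‖v‖ ^ 2 / 8)) * gaussianWeight (x + (2⁻¹ : ℝ) • v)) ^ 2 := by
  unfold gaussianWeight
  rw [mul_pow, ← Real.exp_nat_mul, ← Real.exp_nat_mul, ← Real.exp_add, ← Real.exp_add,
    norm_add_sq_real, norm_add_sq_real, inner_smul_right, norm_smul]
  norm_num
  ring_nf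

/-- With `a`, `b` the square roots of the two weights, `|a² - b²| = |a - b| (a + b)` is split by
AM-GM, and the cross term `a b` is again a Gaussian, centred at the midpoint. This is the Hellinger
bound on total variation in pointwise form; the weight `2 / ‖v‖` makes both parts integrate to at
most `‖v‖ / 2` times the Gaussian mass. -/
theorem abs_gaussianWeight_sub_le (x : E) {v : E} (hv : v ≠ 0) :
    |gaussianWeight (x + v) - gaussianWeight x| ≤
      2 / ‖v‖ * (gaussianWeight (x + v) + gaussianWeight x -
        2 * Real.exp (-(‖v‖ ^ 2 / 8)) * gaussianWeight (x + (2⁻¹ : ℝ) • v)) +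
      ‖v‖ / 4 * (gaussianWeight (x + v) + gaussianWeight x) := by
  have hh : 0 < ‖v‖ := norm_pos_iff.2 hv
  set h := ‖v‖ with hdef
  set a := √(gaussianWeight (x + v)) with ha
  set b := √(gaussianWeight x) with hb
  have ha2 : gaussianWeight (x + v) = a ^ 2 := (Real.sq_sqrt (gaussianWeight_pos _).le).symm
  have hb2 : gaussianWeight x = b ^ 2 := (Real.sq_sqrt (gaussianWeight_pos _).le).symm
  have ha0 : 0 ≤ a := Real.sqrt_nonneg _
  have hb0 : 0 ≤ b := Real.sqrt_nonneg _
  have hab : Real.exp (-(h ^ 2 / 8)) * gaussianWeight (x + (2⁻¹ : ℝ) • v) = a * b := by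
    have h1 := gaussianWeight_mul_gaussianWeight_add x v
    rw [ha2, hb2, ← mul_pow] at h1
    exact ((pow_left_inj₀ (by positivity)
      (mul_nonneg (Real.exp_pos _).le (gaussianWeight_pos _).le) two_ne_zero).1 h1).symm
  rw [mul_assoc, hab, ha2, hb2]
  have h1 : |a ^ 2 - b ^ 2| = |a - b| * (a + b) := by
    rw [sq_sub_sq, abs_mul, abs_of_nonneg (add_nonneg ha0 hb0), mul_comm]
  have h2 : a ^ 2 + b ^ 2 - 2 * (a * b) = |a - b| ^ 2 := by
    rw [sq_abs]; ring
  have h3 : (a + b) ^ 2 ≤ 2 * (a ^ 2 + b ^ 2) := by nlinarith [sq_nonneg (a - b)]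
  have h4 : |a - b| * (a + b) ≤ 2 / h * |a - b| ^ 2 + h / 8 * (a + b) ^ 2 := by
    have : 2 / h * |a - b| ^ 2 + h / 8 * (a + b) ^ 2 - |a - b| * (a + b) =
        2 / h * (|a - b| - h / 4 * (a + b)) ^ 2 := by
      field_simp
      ring
    have h5 : 0 ≤ 2 / h * (|a - b| - h / 4 * (a + b)) ^ 2 := by positivity
    linarith
  rw [h1, h2]
  nlinarith [mul_le_mul_of_nonneg_left h3 hh.le]

variable [FiniteDimensional ℝ E] [MeasurableSpace E] [BorelSpace E]

theorem integrable_gaussianWeight : Integrable (gaussianWeight : E → ℝ) := by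
  have h := GaussianFourier.integrable_cexp_neg_mul_sq_norm_add (V := E) (b := 1 / 2)
    (by norm_num) 0 0
  refine h.norm.congr (Filter.Eventually.of_forall fun x => ?_)
  simp only [gaussianWeight, Complex.norm_exp]
  congr 1
  simp [← Complex.ofReal_pow]
  norm_num
  ring

theorem integral_gaussianWeight_pos : 0 < ∫ x : E, gaussianWeight x := by
  exact integral_pos_of_integrable_nonneg_nonzero (x := 0) continuous_gaussianWeight
    integrable_gaussianWeight (fun x => (gaussianWeight_pos x).le) (gaussianWeight_pos 0).ne'

theorem integral_abs_gaussianWeight_sub_le (v : E) :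
    ∫ x, |gaussianWeight (x + v) - gaussianWeight x| ≤ ‖v‖ * ∫ x : E, gaussianWeight x := by
  rcases eq_or_ne v 0 with rfl | hv
  · simp
  have hh : 0 < ‖v‖ := norm_pos_iff.2 hv
  have hi := integrable_gaussianWeight (E := E)
  have hi1 := hi.comp_add_right v
  have hi2 := (hi.comp_add_right ((2⁻¹ : ℝ) • v)).const_mul (2 * Real.exp (-(‖v‖ ^ 2 / 8)))
  have hi3 := ((hi1.add hi).sub hi2).const_mul (2 / ‖v‖)
  have hi4 := (hi1.add hi).const_mul (‖v‖ / 4)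
  refine (integral_mono (hi1.sub hi).abs (hi3.add hi4)
    fun x => abs_gaussianWeight_sub_le x hv).trans ?_
  rw [integral_add' hi3 hi4, integral_const_mul, integral_const_mul,
    integral_sub' (hi1.add hi) hi2, integral_add' hi1 hi, integral_const_mul,
    integral_add_right_eq_self, integral_add_right_eq_self]
  set Z := ∫ x : E, gaussianWeight x
  have hZ : 0 ≤ Z := integral_nonneg fun x => (gaussianWeight_pos x).le
  have he : 1 - ‖v‖ ^ 2 / 8 ≤ Real.exp (-(‖v‖ ^ 2 / 8)) := by
    have := Real.add_one_le_exp (-(‖v‖ ^ 2 / 8))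
    linarith
  have h1 : Z + Z - 2 * Real.exp (-(‖v‖ ^ 2 / 8)) * Z ≤ ‖v‖ ^ 2 / 4 * Z := by
    nlinarith
  have h2 : 2 / ‖v‖ * (‖v‖ ^ 2 / 4 * Z) = ‖v‖ / 2 * Z := by
    field_simp
    ring
  have h3 := mul_le_mul_of_nonneg_left h1 (by positivity : 0 ≤ 2 / ‖v‖)
  linarith

theorem integrable_exp_inner_mul_gaussianWeight (u : E) :
    Integrable fun x => Real.exp (inner ℝ u x) * gaussianWeight x := by
  simp_rw [exp_inner_mul_gaussianWeight]
  exact (integrable_gaussianWeight.comp_sub_right u).const_mul _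

theorem integral_exp_inner_mul_gaussianWeight (u : E) :
    ∫ x, Real.exp (inner ℝ u x) * gaussianWeight x =
      Real.exp (‖u‖ ^ 2 / 2) * ∫ x : E, gaussianWeight x := by
  simp_rw [exp_inner_mul_gaussianWeight]
  rw [integral_const_mul, integral_sub_right_eq_self]

end Gaussian

/-! ### The Gaussian cut off in a seminorm -/

section TruncatedGaussian

variable {E : Type*} [NormedAddCommGroup E] [InnerProductSpace ℝ E]

/-- The Gaussian weight, cut off outside of the ball of radius `R` for the seminorm `N`. -/
noncomputable def truncatedGaussian (N : Seminorm ℝ E) (R : ℝ) (x : E) : ℝ :=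
  gaussianWeight x * max 0 (1 - N x / R)

variable {N : Seminorm ℝ E} {R : ℝ}

theorem continuous_truncatedGaussian (hN : Continuous N) :
    Continuous (truncatedGaussian N R) := by
  unfold truncatedGaussian
  exact continuous_gaussianWeight.mul (by fun_prop)

theorem truncatedGaussian_nonneg (x : E) : 0 ≤ truncatedGaussian N R x :=
  mul_nonneg (gaussianWeight_pos x).le (le_max_left _ _)

theorem max_zero_one_sub_le_one (hR : 0 < R) (x : E) : max 0 (1 - N x / R) ≤ 1 :=
  max_le zero_le_one (sub_le_self _ (div_nonneg (apply_nonneg N x) hR.le))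

theorem lt_of_truncatedGaussian_pos (hR : 0 < R) {x : E} (hx : 0 < truncatedGaussian N R x) :
    N x < R := by
  by_contra! h
  have : 1 - N x / R ≤ 0 := sub_nonpos.2 ((one_le_div hR).2 h)
  rw [truncatedGaussian, max_eq_left this, mul_zero] at hx
  exact hx.false

/-- Product rule: the cutoff is at most 1 and is `1 / R`-Lipschitz for `N`. -/
theorem abs_truncatedGaussian_sub_le (hR : 0 < R) (x v : E) :
    |truncatedGaussian N R (x + v) - truncatedGaussian N R x| ≤
      |gaussianWeight (x + v) - gaussianWeight x| + N v / R * gaussianWeight x := by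
  set a := max 0 (1 - N (x + v) / R) with ha
  set b := max 0 (1 - N x / R) with hb
  have h1 : truncatedGaussian N R (x + v) - truncatedGaussian N R x =
      (gaussianWeight (x + v) - gaussianWeight x) * a + (a - b) * gaussianWeight x := by
    simp only [truncatedGaussian, ← ha, ← hb]
    ring
  have ha0 : 0 ≤ a := le_max_left _ _
  have ha1 : a ≤ 1 := max_zero_one_sub_le_one hR _
  have hab : |a - b| ≤ N v / R := by
    refine (abs_max_sub_max_le_max _ _ _ _).trans (max_le (by simp; positivity) ?_)
    rw [show 1 - N (x + v) / R - (1 - N x / R) = (N x - N (x + v)) / R by ring, abs_div,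
      abs_of_pos hR]
    gcongr
    refine (abs_sub_map_le_sub N x (x + v)).trans ?_
    rw [sub_add_cancel_left, map_neg_eq_map]
  rw [h1]
  refine (abs_add_le _ _).trans ?_
  rw [abs_mul, abs_mul, abs_of_nonneg ha0, abs_of_pos (gaussianWeight_pos x)]
  exact add_le_add (mul_le_of_le_one_right (abs_nonneg _) ha1)
    (mul_le_mul_of_nonneg_right hab (gaussianWeight_pos x).le)

variable [FiniteDimensional ℝ E] [MeasurableSpace E] [BorelSpace E]

theorem integrable_truncatedGaussian (hN : Continuous N) (hR : 0 < R) :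
    Integrable (truncatedGaussian N R) := by
  refine integrable_gaussianWeight.mono' (continuous_truncatedGaussian hN).aestronglyMeasurable
    (Filter.Eventually.of_forall fun x => ?_)
  rw [Real.norm_of_nonneg (truncatedGaussian_nonneg x)]
  exact mul_le_of_le_one_right (gaussianWeight_pos x).le (max_zero_one_sub_le_one hR x)

theorem integral_abs_truncatedGaussian_sub_le (hN : Continuous N) (hR : 0 < R) (a b : E) :
    ∫ z, |truncatedGaussian N R (a + z) - truncatedGaussian N R (b + z)| ≤
      (‖a - b‖ + N (a - b) / R) * ∫ x : E, gaussianWeight x := by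
  have hi := integrable_gaussianWeight (E := E)
  have hf := integrable_truncatedGaussian hN hR
  have h1 : ∫ z, |truncatedGaussian N R (a + z) - truncatedGaussian N R (b + z)| =
      ∫ x, |truncatedGaussian N R (x + (a - b)) - truncatedGaussian N R x| := by
    rw [← integral_add_left_eq_self
      (fun x => |truncatedGaussian N R (x + (a - b)) - truncatedGaussian N R x|) b]
    refine integral_congr_ae (Filter.Eventually.of_forall fun z => ?_)
    simp only
    rw [show b + z + (a - b) = a + z by abel]
  have h2 := (hi.comp_add_right (a - b)).sub hi |>.abs
  have h3 := hi.const_mul (N (a - b) / R)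
  rw [h1, add_mul]
  refine (integral_mono ((hf.comp_add_right (a - b)).sub hf).abs (h2.add h3)
    fun x => abs_truncatedGaussian_sub_le hR x (a - b)).trans ?_
  rw [integral_add' h2 h3, integral_const_mul]
  gcongr
  exact integral_abs_gaussianWeight_sub_le (a - b)

end TruncatedGaussian

/-- Markov's inequality for `∑ exp |x i|`, whose Gaussian mean is at most `2 d √e ≤ 4 d`: the sum is
at most `8 d` on half of the mass, and there the cutoff is at least `1 / 2`. -/
theorem integral_gaussianWeight_le_integral_truncatedGaussian {d : ℕ} (hd : d ≠ 0)
    {N : Seminorm ℝ (EuclideanSpace ℝ (Fin d))} (hN : Continuous N) {R : ℝ} (hR : 0 < R)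
    (hNR : ∀ x, ∑ i, Real.exp |x i| ≤ 8 * d → N x ≤ R / 2) :
    ∫ x : EuclideanSpace ℝ (Fin d), gaussianWeight x ≤ 4 * ∫ x, truncatedGaussian N R x := by
  set e : Fin d → EuclideanSpace ℝ (Fin d) := fun i => EuclideanSpace.single i 1 with he
  have hd0 : (0 : ℝ) < d := by positivity
  have hinner : ∀ i x, inner ℝ (e i) x = x i := by
    intro i x
    simp [he, EuclideanSpace.inner_single_left]
  set g : EuclideanSpace ℝ (Fin d) → ℝ := fun x =>
    ∑ i, (Real.exp (inner ℝ (e i) x) * gaussianWeight x +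
      Real.exp (inner ℝ (-e i) x) * gaussianWeight x) with hg
  have hgi : Integrable g := integrable_finsetSum _ fun i _ =>
    (integrable_exp_inner_mul_gaussianWeight (e i)).add
      (integrable_exp_inner_mul_gaussianWeight (-e i))
  have hi := integrable_gaussianWeight (E := EuclideanSpace ℝ (Fin d))
  have hpt : ∀ x, gaussianWeight x - 1 / (8 * d) * g x ≤ 2 * truncatedGaussian N R x := by
    intro x
    have hγ := gaussianWeight_pos x
    have hSg : (∑ i, Real.exp |x i|) * gaussianWeight x ≤ g x := by
      rw [Finset.sum_mul]
      refine Finset.sum_le_sum fun i _ => ?_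
      rw [inner_neg_left, hinner, ← add_mul]
      gcongr
      rcases abs_cases (x i) with ⟨h, -⟩ | ⟨h, -⟩ <;> rw [h]
      · exact le_add_of_nonneg_right (Real.exp_pos _).le
      · exact le_add_of_nonneg_left (Real.exp_pos _).le
    by_cases hx : ∑ i, Real.exp |x i| ≤ 8 * d
    · have h1 : N x / R ≤ 1 / 2 := by
        rw [div_le_iff₀ hR]
        linarith [hNR x hx]
      have h2 : 1 / 2 ≤ max 0 (1 - N x / R) := le_max_of_le_right (by linarith)
      have h3 : 0 ≤ g x := le_trans (by positivity) hSg
      have h4 : 0 ≤ 1 / (8 * d) * g x := by positivity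
      have h5 := mul_le_mul_of_nonneg_left h2 hγ.le
      unfold truncatedGaussian
      linarith
    · have h1 : gaussianWeight x ≤ 1 / (8 * d) * g x := by
        rw [one_div, ← div_eq_inv_mul, le_div_iff₀ (by positivity), mul_comm]
        exact (mul_le_mul_of_nonneg_right (not_le.1 hx).le hγ.le).trans hSg
      have := truncatedGaussian_nonneg (N := N) (R := R) x
      linarith
  have hint := integral_mono (hi.sub (hgi.const_mul (1 / (8 * d))))
    ((integrable_truncatedGaussian hN hR).const_mul 2) hpt
  rw [integral_sub' hi (hgi.const_mul _), integral_const_mul, integral_const_mul] at hint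
  have hgint : ∫ x, g x ≤ 4 * d * ∫ x : EuclideanSpace ℝ (Fin d), gaussianWeight x := by
    rw [hg, integral_finsetSum]
    swap
    · exact fun i _ => (integrable_exp_inner_mul_gaussianWeight (e i)).add
        (integrable_exp_inner_mul_gaussianWeight (-e i))
    have hsqrt : Real.exp (1 / 2) ≤ 2 := by
      have h1 : Real.exp (1 / 2) ^ 2 = Real.exp 1 := by
        rw [← Real.exp_nat_mul]
        norm_num
      have h2 := Real.exp_one_lt_d9
      nlinarith [Real.exp_pos (1 / 2)]
    have hZ := integral_gaussianWeight_pos (E := EuclideanSpace ℝ (Fin d))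
    have : ∀ i, ∫ x, (Real.exp (inner ℝ (e i) x) * gaussianWeight x +
        Real.exp (inner ℝ (-e i) x) * gaussianWeight x) ≤
        4 * ∫ x : EuclideanSpace ℝ (Fin d), gaussianWeight x := by
      intro i
      rw [integral_add (integrable_exp_inner_mul_gaussianWeight _)
        (integrable_exp_inner_mul_gaussianWeight _), integral_exp_inner_mul_gaussianWeight,
        integral_exp_inner_mul_gaussianWeight, norm_neg]
      have : ‖e i‖ = 1 := by simp [he]
      rw [this, one_pow]
      nlinarith
    refine (Finset.sum_le_sum fun i _ => this i).trans ?_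
    rw [Finset.sum_const, Finset.card_univ, Fintype.card_fin, nsmul_eq_mul]
    linarith
  have h6 : 1 / (8 * (d : ℝ)) * ∫ x, g x ≤
      1 / 2 * ∫ x : EuclideanSpace ℝ (Fin d), gaussianWeight x := by
    refine (mul_le_mul_of_nonneg_left hgint (by positivity)).trans (le_of_eq ?_)
    field_simp
    ring
  linarith

/-- A Lipschitz decomposition for a finite metric space that embeds isometrically into `ℝᵈ` with
a seminorm. -/
theorem exists_isLipschitzDecomposition_of_seminorm {d : ℕ} (hd : d ≠ 0)
    {N : Seminorm ℝ (EuclideanSpace ℝ (Fin d))} (hN : Continuous N) {R A : ℝ} (hR : 0 < R)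
    (hNR : ∀ x, ∑ i, Real.exp |x i| ≤ 8 * d → N x ≤ R / 2) (hA : 0 ≤ A)
    (hNA : ∀ v, ‖v‖ ≤ A * N v) {M : Type*} [MetricSpace M] [Finite M]
    (T : M → EuclideanSpace ℝ (Fin d)) (hT : ∀ x y, N (T x - T y) = dist x y)
    {Δ : ℝ} (hΔ : 0 < Δ) :
    ∃ D : PMF (Setoid M), IsLipschitzDecomposition D (8 * (A * R + 1)) Δ := by
  have hZ := integral_gaussianWeight_pos (E := EuclideanSpace ℝ (Fin d))
  have hZf := integral_gaussianWeight_le_integral_truncatedGaussian hd hN hR hNR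
  -- The support of the density has `N`-diameter at most `2 R`; this scaling matches it to `Δ`.
  set c := 2 * R / Δ with hc
  have hc0 : 0 < c := by positivity
  have hcN : ∀ x y, N (c • T x - c • T y) = c * dist x y := by
    intro x y
    rw [← smul_sub, map_smul_eq_mul, hT, Real.norm_of_nonneg hc0.le]
  refine exists_isLipschitzDecomposition_of_density (continuous_truncatedGaussian (R := R) hN)
    truncatedGaussian_nonneg (integrable_truncatedGaussian hN hR) (by linarith)
    (fun x => c • T x) hΔ (by positivity) ?_ ?_
  · intro x y z hx hy
    have h1 := lt_of_truncatedGaussian_pos hR hx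
    have h2 := lt_of_truncatedGaussian_pos hR hy
    have h3 := map_sub_le_add N (c • T x + z) (c • T y + z)
    rw [add_sub_add_right_eq_sub, hcN] at h3
    have h4 : c * dist x y ≤ c * Δ := by
      have : c * Δ = 2 * R := by rw [hc]; field_simp
      linarith
    exact le_of_mul_le_mul_left h4 hc0
  · intro x y
    refine (integral_abs_truncatedGaussian_sub_le hN hR _ _).trans ?_
    have h1 : ‖c • T x - c • T y‖ + N (c • T x - c • T y) / R ≤ (A + 1 / R) * (c * dist x y) := by
      have := hNA (c • T x - c • T y)
      rw [hcN] at this ⊢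
      have h : c * dist x y / R = 1 / R * (c * dist x y) := by ring
      linarith
    refine (mul_le_mul_of_nonneg_right h1 hZ.le).trans ?_
    refine (mul_le_mul_of_nonneg_left hZf (by positivity)).trans (le_of_eq ?_)
    rw [hc]
    field_simp
    ring

/-! ### Estimates for `ℓ_p` norms -/

theorem PiLp.norm_toLp_le_of_abs_le {d : ℕ} (p : ℝ≥0∞) [Fact (1 ≤ p)] {x : Fin d → ℝ} {B : ℝ}
    (hB : 0 ≤ B) (hx : ∀ i, |x i| ≤ B) :
    ‖WithLp.toLp p x‖ ≤ (d : ℝ) ^ (1 / p.toReal) * B := by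
  rcases eq_or_ne p ∞ with rfl | hp
  · rw [PiLp.norm_eq_ciSup]
    simpa using Real.iSup_le hx hB
  have hp0 : 0 < p.toReal := ENNReal.toReal_pos (zero_lt_one.trans_le Fact.out).ne' hp
  rw [PiLp.norm_eq_sum hp0]
  calc (∑ i, ‖x i‖ ^ p.toReal) ^ (1 / p.toReal)
      ≤ (∑ _i : Fin d, B ^ p.toReal) ^ (1 / p.toReal) := by
        gcongr with i
        exact hx i
    _ = (d : ℝ) ^ (1 / p.toReal) * B := by
        rw [Finset.sum_const, Finset.card_univ, Fintype.card_fin, nsmul_eq_mul,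
          Real.mul_rpow (by positivity) (by positivity), ← Real.rpow_mul hB,
          mul_one_div_cancel hp0.ne', Real.rpow_one]

/-- Power mean inequality with exponent `p / 2`. At `p = ∞` the conventions `∞.toReal = 0` and `1 /
0 = 0` give the right factor `d ^ 0 = 1`. -/
theorem PiLp.rpow_mul_norm_toLp_two_le {d : ℕ} (hd : d ≠ 0) (p : ℝ≥0∞) [Fact (1 ≤ p)]
    (hp2 : 2 ≤ p) (x : Fin d → ℝ) :
    (d : ℝ) ^ (1 / p.toReal) * ‖WithLp.toLp 2 x‖ ≤ √d * ‖WithLp.toLp p x‖ := by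
  rcases eq_or_ne p ∞ with rfl | hp
  · have := PiLp.norm_toLp_le_of_abs_le 2 (norm_nonneg (WithLp.toLp ∞ x))
      (fun i => PiLp.norm_apply_le (WithLp.toLp ∞ x) i)
    simpa [Real.sqrt_eq_rpow] using this
  set q := p.toReal with hq
  have hq2 : 2 ≤ q := by
    have := ENNReal.toReal_mono hp hp2
    simpa using this
  have hq0 : 0 < q := by linarith
  have hd0 : (0 : ℝ) < d := by positivity
  have hmean := Real.rpow_arith_mean_le_arith_mean_rpow Finset.univ (fun _ : Fin d => (d : ℝ)⁻¹)
    (fun i => |x i| ^ 2) (fun _ _ => by positivity) (by simp [hd]) (fun _ _ => by positivity)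
    (p := q / 2) (by linarith)
  simp_rw [← Finset.mul_sum] at hmean
  have hpow : ∀ i, (|x i| ^ 2) ^ (q / 2) = |x i| ^ q := by
    intro i
    rw [← Real.rpow_natCast_mul (abs_nonneg _)]
    congr 1
    push_cast
    ring
  simp_rw [hpow] at hmean
  have h2 : ∑ i, |x i| ^ 2 = ‖WithLp.toLp 2 x‖ ^ 2 := by
    rw [EuclideanSpace.norm_sq_eq]
    rfl
  have h3 : ∑ i, |x i| ^ q = ‖WithLp.toLp p x‖ ^ q := by
    rw [PiLp.norm_eq_sum (by rwa [← hq]), ← Real.rpow_mul (by positivity), ← hq,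
      one_div_mul_cancel hq0.ne', Real.rpow_one]
    rfl
  rw [h2, h3] at hmean
  have h4 : ((d : ℝ) ^ (1 / q) * ‖WithLp.toLp 2 x‖) ^ q ≤ (√d * ‖WithLp.toLp p x‖) ^ q := by
    rw [Real.mul_rpow (by positivity) (by positivity), Real.mul_rpow (by positivity) (by positivity),
      ← Real.rpow_mul hd0.le, one_div_mul_cancel hq0.ne', Real.rpow_one]
    rw [Real.mul_rpow (by positivity) (by positivity),
      ← Real.rpow_natCast_mul (norm_nonneg _), Real.inv_rpow hd0.le] at hmean
    have h5 : √(d : ℝ) ^ q = (d : ℝ) ^ (q / 2) := by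
      rw [Real.sqrt_eq_rpow, ← Real.rpow_mul hd0.le]
      congr 1
      ring
    rw [h5]
    have h6 : ((2 : ℕ) : ℝ) * (q / 2) = q := by push_cast; ring
    rw [h6] at hmean
    have h7 : 0 < (d : ℝ) ^ (q / 2) := by positivity
    calc (d : ℝ) * ‖WithLp.toLp 2 x‖ ^ q
        = d * (d : ℝ) ^ (q / 2) * (((d : ℝ) ^ (q / 2))⁻¹ * ‖WithLp.toLp 2 x‖ ^ q) := by
          field_simp
      _ ≤ d * (d : ℝ) ^ (q / 2) * ((d : ℝ)⁻¹ * ‖WithLp.toLp p x‖ ^ q) := by gcongr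
      _ = (d : ℝ) ^ (q / 2) * ‖WithLp.toLp p x‖ ^ q := by field_simp
  exact (Real.rpow_le_rpow_iff (by positivity) (by positivity) hq0).1 h4

theorem PiLp.norm_toLp_le_of_sum_exp_le_log {d : ℕ} (hd : d ≠ 0) (p : ℝ≥0∞) [Fact (1 ≤ p)]
    {x : Fin d → ℝ} (hx : ∑ i, Real.exp |x i| ≤ 8 * d) :
    ‖WithLp.toLp p x‖ ≤ (d : ℝ) ^ (1 / p.toReal) * Real.log (8 * d) := by
  have hd1 : (1 : ℝ) ≤ d := by exact_mod_cast Nat.one_le_iff_ne_zero.2 hd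
  refine PiLp.norm_toLp_le_of_abs_le p (Real.log_nonneg (by linarith)) fun i => ?_
  rw [Real.le_log_iff_exp_le (by linarith)]
  exact (Finset.single_le_sum (f := fun i => Real.exp |x i|) (fun _ _ => (Real.exp_pos _).le)
    (Finset.mem_univ i)).trans hx

theorem PiLp.norm_toLp_le_of_sum_exp_le {d : ℕ} (p : ℝ≥0∞) [Fact (1 ≤ p)] (hp : p ≠ ∞)
    {x : Fin d → ℝ} (hx : ∑ i, Real.exp |x i| ≤ 8 * d) :
    ‖WithLp.toLp p x‖ ≤ (d : ℝ) ^ (1 / p.toReal) * (8 * p.toReal) := by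
  have hq1 : 1 ≤ p.toReal := by
    have := ENNReal.toReal_mono hp (Fact.out : 1 ≤ p)
    simpa using this
  set q := p.toReal with hq
  have hq0 : 0 < q := by linarith
  -- This is the `q`-th power of `|t| / q ≤ exp (|t| / q)`.
  have hpt : ∀ t : ℝ, |t| ^ q ≤ q ^ q * Real.exp |t| := by
    intro t
    have h1 : |t| / q ≤ Real.exp (|t| / q) := by
      have := Real.add_one_le_exp (|t| / q)
      linarith
    have h2 := Real.rpow_le_rpow (by positivity) h1 hq0.le
    rwa [← Real.exp_mul, div_mul_cancel₀ _ hq0.ne', Real.div_rpow (abs_nonneg _) hq0.le,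
      div_le_iff₀ (by positivity), mul_comm] at h2
  rw [PiLp.norm_eq_sum (by rwa [← hq]), ← hq]
  calc (∑ i, ‖x i‖ ^ q) ^ (1 / q)
      ≤ (q ^ q * (8 * d)) ^ (1 / q) := by
        gcongr
        refine (Finset.sum_le_sum fun i _ => hpt (x i)).trans ?_
        rw [← Finset.mul_sum]
        gcongr
    _ = q * (8 ^ (1 / q) * (d : ℝ) ^ (1 / q)) := by
        rw [Real.mul_rpow (by positivity) (by positivity), ← Real.rpow_mul hq0.le,
          mul_one_div_cancel hq0.ne', Real.rpow_one, Real.mul_rpow (by norm_num) (by positivity)]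
    _ ≤ q * (8 * (d : ℝ) ^ (1 / q)) := by
        gcongr
        exact Real.rpow_le_self_of_one_le (by norm_num) ((div_le_one hq0).2 hq1)
    _ = (d : ℝ) ^ (1 / q) * (8 * q) := by ring

/-! ### Assembling the bound for `ℓ_p^d` -/

/-- The seminorm on `ℝᵈ` given by the `ℓ_p` norm. -/
noncomputable def lpSeminorm (p : ℝ≥0∞) [Fact (1 ≤ p)] (d : ℕ) :
    Seminorm ℝ (EuclideanSpace ℝ (Fin d)) :=
  (normSeminorm ℝ (PiLp p fun _ : Fin d => ℝ)).comp
    ((WithLp.linearEquiv p ℝ (Fin d → ℝ)).symm.toLinearMap ∘ₗ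
      (WithLp.linearEquiv 2 ℝ (Fin d → ℝ)).toLinearMap)

theorem lpSeminorm_apply (p : ℝ≥0∞) [Fact (1 ≤ p)] (d : ℕ) (x : EuclideanSpace ℝ (Fin d)) :
    lpSeminorm p d x = ‖WithLp.toLp p (WithLp.ofLp x)‖ := rfl

theorem continuous_lpSeminorm (p : ℝ≥0∞) [Fact (1 ≤ p)] (d : ℕ) :
    Continuous (lpSeminorm p d) :=
  (LinearMap.continuous_of_finiteDimensional
    ((WithLp.linearEquiv p ℝ (Fin d → ℝ)).symm.toLinearMap ∘ₗ
      (WithLp.linearEquiv 2 ℝ (Fin d → ℝ)).toLinearMap)).norm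

theorem decompositionParameter_piLp_le {d : ℕ} (hd : d ≠ 0) (p : ℝ≥0∞) [Fact (1 ≤ p)]
    (hp2 : 2 ≤ p) {L : ℝ} (hL : 0 < L)
    (hpL : ∀ x : Fin d → ℝ, ∑ i, Real.exp |x i| ≤ 8 * d →
      ‖WithLp.toLp p x‖ ≤ (d : ℝ) ^ (1 / p.toReal) * L) :
    decompositionParameter (PiLp p fun _ : Fin d => ℝ) ≤
      ENNReal.ofReal (8 * (2 * √d * L + 1)) := by
  refine sInf_le ⟨_, rfl, ?_, fun Δ hΔ S hS => ?_⟩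
  · have : 0 ≤ 2 * √d * L := by positivity
    linarith
  have := hS.to_subtype
  have hD : 0 < (d : ℝ) ^ (1 / p.toReal) := by positivity
  have h := exists_isLipschitzDecomposition_of_seminorm hd (continuous_lpSeminorm p d)
    -- The factors `d ^ (1 / p)` cancel in `A * R = 2 √d L`.
    (R := 2 * ((d : ℝ) ^ (1 / p.toReal) * L)) (A := √d / (d : ℝ) ^ (1 / p.toReal))
    (by positivity) (fun x hx => by
      rw [lpSeminorm_apply]
      linarith [hpL _ hx]) (by positivity)
    (fun v => by
      rw [lpSeminorm_apply, div_mul_eq_mul_div, le_div_iff₀ hD, mul_comm]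
      exact PiLp.rpow_mul_norm_toLp_two_le hd p hp2 v.ofLp)
    (fun x : S => WithLp.toLp 2 (WithLp.ofLp x.1)) (fun x y => by
      rw [lpSeminorm_apply, Subtype.dist_eq, dist_eq_norm]
      rfl) hΔ
  convert h using 2
  field_simp

/-- Here `m` stands for `min(p, log d)`, which is at least `log 2 > 1 / 2`; this lower bound lets `m
^ 4` absorb both `m` and the constant. -/
theorem le_pow_four_mul {m L s : ℝ} (hm : 1 / 2 ≤ m) (hL : L ≤ 8 * m) (hs : 1 ≤ s) :
    8 * (2 * s * L + 1) ≤ 2000 * m ^ 4 * s := by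
  have h3 : (1 / 2) ^ 3 ≤ m ^ 3 := by gcongr
  have h4 : (1 / 2) ^ 4 ≤ m ^ 4 := by gcongr
  have h1 : m ≤ 8 * m ^ 4 := by nlinarith
  have h2 : 8 * (2 * L + 1) ≤ 2000 * m ^ 4 := by linarith
  have h5 := mul_le_mul_of_nonneg_right h2 (by linarith : 0 ≤ s)
  linarith

theorem mainTheorem3 :
    ∃ C : ℝ≥0, ∀ (p : ℝ≥0∞) [Fact (1 ≤ p)], 2 ≤ p →
      (∀ d : ℕ, 2 ≤ d →
        decompositionParameter (PiLp p (fun _ : Fin d => ℝ)) ≤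
          (C : ℝ≥0∞) * (min p (ENNReal.ofReal (Real.log d))) ^ 4 * ENNReal.ofReal (Real.sqrt d)) ∧
      decompositionParameter (PiLp p (fun _ : Fin 1 => ℝ)) ≤ (C : ℝ≥0∞) := by
  refine ⟨2000, fun p _ hp2 => ⟨fun d hd => ?_, ?_⟩⟩
  · have hd0 : d ≠ 0 := by omega
    have hd2 : (2 : ℝ) ≤ d := by exact_mod_cast hd
    have hs : 1 ≤ √(d : ℝ) := Real.one_le_sqrt.2 (by linarith)
    have hcast : ∀ m : ℝ, 0 ≤ m → ((2000 : ℝ≥0) : ℝ≥0∞) * ENNReal.ofReal m ^ 4 *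
        ENNReal.ofReal √d = ENNReal.ofReal (2000 * m ^ 4 * √d) := by
      intro m hm
      rw [ENNReal.ofReal_mul (by positivity), ENNReal.ofReal_mul (by positivity),
        ENNReal.ofReal_pow hm]
      norm_num
    rcases le_total p (ENNReal.ofReal (Real.log d)) with h | h
    · have hp : p ≠ ∞ := ne_top_of_le_ne_top ENNReal.ofReal_ne_top h
      have hq2 : 2 ≤ p.toReal := by simpa using ENNReal.toReal_mono hp hp2
      have hcast' := hcast p.toReal (by positivity)
      rw [ENNReal.ofReal_toReal hp] at hcast'
      rw [min_eq_left h, hcast']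
      exact (decompositionParameter_piLp_le hd0 p hp2 (by linarith)
        fun x hx => PiLp.norm_toLp_le_of_sum_exp_le p hp hx).trans
        (ENNReal.ofReal_le_ofReal (le_pow_four_mul (by linarith) le_rfl hs))
    · have hlog2 := Real.log_two_gt_d9
      have hlog : Real.log 2 ≤ Real.log d := Real.log_le_log (by norm_num) hd2
      -- As `d ≥ 2`, this is at most `4 log d`, within the allowed `8 m`.
      have h8 : Real.log (8 * d) = 3 * Real.log 2 + Real.log d := by
        rw [Real.log_mul (by norm_num) (by positivity), show (8 : ℝ) = 2 ^ 3 by norm_num,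
          Real.log_pow]
        norm_num
      rw [min_eq_right h, hcast _ (by linarith)]
      exact (decompositionParameter_piLp_le hd0 p hp2 (by linarith)
        fun x hx => PiLp.norm_toLp_le_of_sum_exp_le_log hd0 p hx).trans
        (ENNReal.ofReal_le_ofReal (le_pow_four_mul (by linarith) (by linarith) hs))
  · have h8 : Real.log (8 * (1 : ℕ)) ≤ 8 := by
      have := Real.log_le_sub_one_of_pos (by norm_num : (0 : ℝ) < 8 * (1 : ℕ))
      push_cast at this ⊢
      linarith
    refine (decompositionParameter_piLp_le one_ne_zero p hp2 (Real.log_pos (by norm_num))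
        fun x hx => PiLp.norm_toLp_le_of_sum_exp_le_log one_ne_zero p hx).trans ?_
    rw [← ENNReal.ofReal_coe_nnreal]
    refine ENNReal.ofReal_le_ofReal ?_
    rw [Nat.cast_one, Real.sqrt_one] at *
    norm_num at *
    linarith
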